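/- For $n\ge 2$ let $\mathbf I_n$ be the set of $(2,4,6,\dots)$-inversion sequences of length $n$, that is, of the sequences $\mathbf e=(e_1,\dots,e_n)$ of integers with $0\le e_k<2k$ for $1\le k\le n$. For $\mathbf e\in\mathbf I_n$ let $\operatorname{exc}\mathbf e$ be the number of $k\in\{1,\dots,n\}$ with $e_k\ge k$, and let $\operatorname{asc}_D\mathbf e$ be the number of elements of $$\Big\{k\in\{1,\dots,n-1\}:\ \frac{e_k}{k}<\frac{e_{k+1}}{k+1}\Big\}\ \cup\ \Big\{0:\ \text{if } e_1+\frac{e_2}{2}\ge\frac32\Big\}.$$ For $0\le i\le 2n-1$ and real $q$ define the polynomial in $x$ $$T_{n,i}(x;q)=\sum_{\mathbf e\in\mathbf I_n,\ e_n=i} q^{\operatorname{exc}\mathbf e}\,x^{\operatorname{asc}_D\mathbf e}.$$ Let $f,g$ be real polynomials with positive leading coefficients that have only real zeros, and let $u_1\ge u_2\ge\cdots$ and $v_1\ge v_2\ge\cdots$ be the zeros of $f$ and of $g$, respectively, listed with multiplicity. We say that $g$ interlaces $f$ if either $\deg f=\deg g=d$ and $v_d\le u_d\le v_{d-1}\le\cdots\le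 v_1\le u_1$, or $\deg f=\deg g+1=d$ and $u_d\le v_{d-1}\le u_{d-1}\le\cdots\le v_1\le u_1$. A finite sequence of real polynomials with positive leading coefficients is mutually interlacing if each of its members interlaces every later one. **Proposition.** For every integer $n\ge4$ and every real $q>0$, the sequence $\big(T_{n,i}(x;q)\big)_{i=0}^{2n-1}$ is mutually interlacing. -/

import Mathlib

open Polynomial

/-- An `n`-dimensional `s`-inversion sequence `(e_1, …, e_n)`, i.e. a sequence of natural numbers
with `e_k < s k` for `1 ≤ k ≤ n`. Sequences are numbered from `1`, so that `e_k` sits at the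
position `k - 1` of `Fin n`. -/
abbrev InversionSeq (s : ℕ → ℕ) (n : ℕ) : Type := (k : Fin n) → Fin (s (k.val + 1))

/-- The entry `e_k` for `1 ≤ k ≤ n` (and `0` for any other `k`). -/
def InversionSeq.entry {s : ℕ → ℕ} {n : ℕ} (e : InversionSeq s n) (k : ℕ) : ℕ :=
  if h : 1 ≤ k ∧ k ≤ n then (e ⟨k - 1, by omega⟩).val else 0

/-- The sequence `(2, 4, 6, …)`, numbered from `1`. -/
def evenSeq (k : ℕ) : ℕ := 2 * k

/-- The set of type `D` ascents of `e = (e_1, …, e_n)`, `n ≥ 2`: the `k ∈ {1, …, n - 1}` with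
`e_k / k < e_{k+1} / (k+1)`, together with `0` in case `e_1 + e_2 / 2 ≥ 3 / 2`. -/
def AscD {n : ℕ} (e : InversionSeq evenSeq n) : Finset ℕ :=
  (Finset.Icc 1 (n - 1)).filter
      (fun k => (e.entry k : ℚ) / (k : ℚ) < (e.entry (k + 1) : ℚ) / ((k : ℚ) + 1)) ∪
    if (3 / 2 : ℚ) ≤ (e.entry 1 : ℚ) + (e.entry 2 : ℚ) / 2 then {0} else ∅

/-- `asc_D e`, the number of type `D` ascents. -/
def ascD {n : ℕ} (e : InversionSeq evenSeq n) : ℕ := (AscD e).card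

/-- `exc e`, the number of `k ∈ {1, …, n}` with `e_k ≥ k`. -/
def exc {n : ℕ} (e : InversionSeq evenSeq n) : ℕ :=
  ((Finset.Icc 1 n).filter (fun k => k ≤ e.entry k)).card

/-- The polynomial `T_{n,i}(x;q) = ∑_e χ(e_n = i) q^{exc e} x^{asc_D e}` in `x`, the sum being over
all `n`-dimensional `(2,4,6,…)`-inversion sequences. -/
noncomputable def refinedEulerianD (n i : ℕ) (q : ℝ) : ℝ[X] :=
  ∑ e : InversionSeq evenSeq n, if e.entry n = i then C (q ^ exc e) * X ^ ascD e else 0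

/-- `g` interlaces `f`. Both are real-rooted with positive leading coefficients, and their zeros
`u 0 ≥ u 1 ≥ …` (of `f`) and `v 0 ≥ v 1 ≥ …` (of `g`), listed with multiplicity, satisfy
`v_{n-1} ≤ u_{n-1} ≤ ⋯ ≤ v 0 ≤ u 0` if `deg f = deg g = n`, and
`u_{n-1} ≤ v_{n-2} ≤ ⋯ ≤ v 0 ≤ u 0` if `deg f = deg g + 1 = n`. -/
def Interlaces (g f : ℝ[X]) : Prop :=
  (0 < g.leadingCoeff ∧ g.Splits) ∧ (0 < f.leadingCoeff ∧ f.Splits) ∧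
    (f.natDegree = g.natDegree ∨ f.natDegree = g.natDegree + 1) ∧
    ∃ u v : ℕ → ℝ,
      f.roots = (Multiset.range f.natDegree).map u ∧
      g.roots = (Multiset.range g.natDegree).map v ∧
      (∀ k, k < g.natDegree → v k ≤ u k) ∧
      (∀ k, k + 1 < f.natDegree → u (k + 1) ≤ v k)

/-- A finite sequence of real polynomials with positive leading coefficients is mutually
interlacing if each of its members interlaces all the later ones. -/
def MutuallyInterlacing {m : ℕ} (f : Fin m → ℝ[X]) : Prop :=
  (∀ i, 0 < (f i).leadingCoeff) ∧ ∀ i j, i < j → Interlaces (f i) (f j)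

/-! For real-rooted f, g with positive leading coefficients, interlacing follows from Im(f(z) · conj
g(z)) ≥ 0 on the upper half-plane. The argument of f(z)/g(z), continued from 0 at +∞, then stays in
[0, π]; as z descends to a real t it tends to π times the difference of the numbers of zeros to the
right of t, so these numbers differ by 0 or 1 (`HalfPlaneLE.countP_roots`).

It thus suffices to control, at each fixed z, the 2n values T_{n,i}(z): they are nonzero, and their
arguments increase weakly with i with total spread at most arg z (`SectorOrdered`). Nonvanishing
also gives real-rootedness. Appending an entry writes T_{n+1,i} as a positive factor times the sum
of all T_{n,l}, where an initial segment of terms, growing with i, is multiplied by z; this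
preserves the property (`SectorOrdered.transform`).

The induction starts at n = 4 because the claim fails earlier: T_{2,0} is constant while T_{2,3} has
degree 2, and both zeros -1, -1/q of T_{3,0} exceed the zero -1 - 2/q of T_{3,1}. For n = 4, only
quadratics and one cubic occur up to positive factors and powers of z, and positivity of Bézout
matrices reduces the claim to polynomial inequalities in q (`im_cubic_mul_conj_cubic`). -/

/-! ### Interlacing from an inequality on the upper half-plane -/

open Filter Topology in
theorem tendsto_arg_add_mul_I_atTop (u ε : ℝ) :
    Tendsto (fun t : ℝ => Complex.arg ((t : ℂ) + ε * Complex.I - u)) atTop (𝓝 0) := by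
  have h1 : Tendsto (fun t : ℝ => ε / (t - u)) atTop (𝓝 0) :=
    Tendsto.const_div_atTop (tendsto_atTop_add_const_right _ (-u) tendsto_id) ε
  have h2 : Tendsto (fun t : ℝ => (1 : ℂ) + ((ε / (t - u) : ℝ) : ℂ) * Complex.I) atTop (𝓝 1) := by
    have := ((Complex.continuous_ofReal.tendsto 0).comp h1).mul_const Complex.I
    simpa using this.const_add 1
  have h3 := (Complex.continuousAt_arg Complex.one_mem_slitPlane).tendsto.comp h2
  rw [Complex.arg_one] at h3
  refine h3.congr' ?_
  filter_upwards [eventually_gt_atTop u] with t ht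
  have hp : 0 < t - u := sub_pos.2 ht
  have hne : ((t : ℂ) - u) ≠ 0 := by
    rw [← Complex.ofReal_sub]; exact_mod_cast hp.ne'
  rw [Function.comp_apply, ← Complex.arg_real_mul _ hp]
  congr 1
  push_cast
  field_simp
  ring

/-- The sum of the arguments of `z - u`, where `u` runs over the multiset `s`. -/
noncomputable def argSum (s : Multiset ℝ) (z : ℂ) : ℝ :=
  (s.map fun u : ℝ => Complex.arg (z - u)).sum

theorem argSum_cons (u : ℝ) (s : Multiset ℝ) (z : ℂ) :
    argSum (u ::ₘ s) z = Complex.arg (z - u) + argSum s z := by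
  simp [argSum]

theorem exists_prod_sub_eq_exp_argSum (s : Multiset ℝ) {z : ℂ} (hz : 0 < z.im) :
    ∃ r : ℝ, 0 < r ∧
      (s.map fun u : ℝ => z - (u : ℂ)).prod = r * Complex.exp (argSum s z * Complex.I) := by
  induction s using Multiset.induction with
  | empty => exact ⟨1, one_pos, by simp [argSum]⟩
  | cons u s ih =>
    obtain ⟨r, hr, h⟩ := ih
    have hne : z - (u : ℂ) ≠ 0 := by
      intro h0
      have := congrArg Complex.im h0
      simp at this
      exact hz.ne' this
    refine ⟨‖z - (u : ℂ)‖ * r, mul_pos (norm_pos_iff.2 hne) hr, ?_⟩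
    rw [Multiset.map_cons, Multiset.prod_cons, h, argSum_cons]
    conv_lhs => rw [← Complex.norm_mul_exp_arg_mul_I (z - u)]
    push_cast
    rw [add_mul, Complex.exp_add]
    ring

theorem continuous_argSum (s : Multiset ℝ) {ε : ℝ} (hε : 0 < ε) :
    Continuous fun t : ℝ => argSum s ((t : ℂ) + ε * Complex.I) := by
  induction s using Multiset.induction with
  | empty => simpa [argSum] using continuous_const
  | cons u s ih =>
    simp only [argSum_cons]
    refine Continuous.add ?_ ih
    rw [continuous_iff_continuousAt]
    intro t
    refine ContinuousAt.comp (f := fun t : ℝ => (t : ℂ) + ε * Complex.I - u)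
      (Complex.continuousAt_arg ?_) (by fun_prop)
    rw [Complex.mem_slitPlane_iff]
    right
    simp [hε.ne']

open Filter Topology in
theorem tendsto_argSum_atTop (s : Multiset ℝ) (ε : ℝ) :
    Tendsto (fun t : ℝ => argSum s ((t : ℂ) + ε * Complex.I)) atTop (𝓝 0) := by
  induction s using Multiset.induction with
  | empty => simp [argSum]
  | cons u s ih =>
    simp only [argSum_cons]
    simpa using (tendsto_arg_add_mul_I_atTop u ε).add ih

-- As ε decreases to 0, the argument of t - u + iε tends to π when t < u and to 0 when u < t.
open Filter Topology in
theorem tendsto_argSum_nhdsGT (s : Multiset ℝ) (t : ℝ) (ht : t ∉ s) :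
    Tendsto (fun ε : ℝ => argSum s ((t : ℂ) + ε * Complex.I)) (𝓝[>] 0)
      (𝓝 (s.countP (t < ·) * Real.pi)) := by
  induction s using Multiset.induction with
  | empty => simp [argSum]
  | cons u s ih =>
    simp only [argSum_cons]
    rw [Multiset.mem_cons, not_or] at ht
    have key : Tendsto (fun ε : ℝ => Complex.arg ((t : ℂ) + ε * Complex.I - u)) (𝓝[>] 0)
        (𝓝 (if t < u then Real.pi else 0)) := by
      have hc : Tendsto (fun ε : ℝ => (t : ℂ) + ε * Complex.I - u) (𝓝[>] 0)
          (𝓝[{w : ℂ | 0 ≤ w.im}] (((t - u : ℝ)) : ℂ)) := by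
        refine tendsto_nhdsWithin_iff.2 ⟨?_, ?_⟩
        · have : ContinuousAt (fun ε : ℝ => (t : ℂ) + ε * Complex.I - u) 0 := by fun_prop
          have h := this.tendsto
          simp only [Complex.ofReal_zero, zero_mul, add_zero, ← Complex.ofReal_sub] at h
          exact h.mono_left nhdsWithin_le_nhds
        · filter_upwards [self_mem_nhdsWithin] with ε hε
          simpa using (le_of_lt hε)
      split_ifs with h
      · exact (Complex.tendsto_arg_nhdsWithin_im_nonneg_of_re_neg_of_im_zero
          (by simpa using h) (by simp)).comp hc
      · have hlt : u < t := lt_of_le_of_ne (not_lt.1 h) (Ne.symm ht.1)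
        have h1 := (Complex.continuousAt_arg (x := ((t - u : ℝ) : ℂ))
          (by rw [Complex.mem_slitPlane_iff]; left; simpa using hlt)).tendsto
        rw [Complex.arg_ofReal_of_nonneg (sub_pos.2 hlt).le] at h1
        exact (h1.mono_left nhdsWithin_le_nhds).comp hc
    convert key.add (ih ht.2) using 2
    rw [Multiset.countP_cons]
    split_ifs
    · push_cast; ring
    · push_cast; ring

theorem aeval_eq_exp_argSum {f : ℝ[X]} (hf : f.Splits) (h0 : 0 < f.leadingCoeff) {z : ℂ}
    (hz : 0 < z.im) :
    ∃ r : ℝ, 0 < r ∧ aeval z f = r * Complex.exp (argSum f.roots z * Complex.I) := by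
  obtain ⟨r, hr, h⟩ := exists_prod_sub_eq_exp_argSum f.roots hz
  refine ⟨f.leadingCoeff * r, mul_pos h0 hr, ?_⟩
  conv_lhs => rw [hf.eq_prod_roots]
  rw [map_mul, map_multiset_prod, Multiset.map_map]
  have : (f.roots.map ((aeval z : ℝ[X] →ₐ[ℝ] ℂ) ∘ fun a : ℝ => X - C a)) =
      f.roots.map fun u : ℝ => z - (u : ℂ) := by
    refine Multiset.map_congr rfl fun u _ => ?_
    simp
  rw [this, h]
  simp
  ring

/-- The order `g ≪ f` expressed by the values on the upper half-plane. -/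
def HalfPlaneLE (g f : ℝ[X]) : Prop :=
  ∀ z : ℂ, 0 < z.im → 0 ≤ (aeval z f * (starRingEnd ℂ) (aeval z g)).im

theorem HalfPlaneLE.sin_nonneg {g f : ℝ[X]} (h : HalfPlaneLE g f)
    (hg : g.Splits) (hg0 : 0 < g.leadingCoeff) (hf : f.Splits) (hf0 : 0 < f.leadingCoeff)
    {z : ℂ} (hz : 0 < z.im) : 0 ≤ Real.sin (argSum f.roots z - argSum g.roots z) := by
  obtain ⟨r, hr, h1⟩ := aeval_eq_exp_argSum hf hf0 hz
  obtain ⟨r', hr', h2⟩ := aeval_eq_exp_argSum hg hg0 hz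
  have := h z hz
  rw [h1, h2, map_mul, ← Complex.exp_conj, map_mul, Complex.conj_I, Complex.conj_ofReal,
    Complex.conj_ofReal] at this
  have e : ((r : ℂ) * Complex.exp (argSum f.roots z * Complex.I) *
      (r' * Complex.exp (argSum g.roots z * -Complex.I))) =
      ((r * r' : ℝ) : ℂ) *
        Complex.exp (((argSum f.roots z - argSum g.roots z : ℝ) : ℂ) * Complex.I) := by
    push_cast
    rw [sub_mul, sub_eq_add_neg, Complex.exp_add, mul_neg]
    ring
  rw [e, Complex.im_ofReal_mul, Complex.exp_ofReal_mul_I_im] at this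
  exact nonneg_of_mul_nonneg_right this (mul_pos hr hr')

open Filter Topology in
/-- A continuous function tending to `0` at infinity whose sine is nonnegative has values
in `[0, π]`. -/
theorem mem_Icc_zero_pi_of_sin_nonneg {D : ℝ → ℝ} (hc : Continuous D)
    (hlim : Tendsto D atTop (𝓝 0)) (hs : ∀ t, 0 ≤ Real.sin (D t)) (t : ℝ) :
    D t ∈ Set.Icc 0 Real.pi := by
  have hpi := Real.pi_pos
  by_contra hcon
  have hex : ∀ δ > 0, ∃ b, |D b| < δ := by
    intro δ hδ
    have := (Metric.tendsto_nhds.1 hlim δ hδ).exists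
    simpa [Real.dist_eq] using this
  rw [Set.mem_Icc, not_and_or, not_le, not_le] at hcon
  have hIVT : ∀ b, Set.uIcc (D b) (D t) ⊆ Set.range D := fun b =>
    (intermediate_value_uIcc hc.continuousOn).trans (Set.image_subset_range _ _)
  rcases hcon with h | h
  -- Capping at -π/2 keeps the intermediate value inside (-π, 0), where the sine is negative.
  · set m := max (D t) (-(Real.pi / 2)) with hm
    have hm0 : m < 0 := max_lt h (by linarith)
    obtain ⟨b, hb⟩ := hex (-m) (by linarith)
    rw [abs_lt] at hb
    obtain ⟨x, hx⟩ := hIVT b (Set.mem_uIcc.2 (Or.inr ⟨le_max_left _ _, by linarith⟩) : m ∈ _)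
    have := hs x
    rw [hx] at this
    have h2 : -(Real.pi / 2) ≤ m := le_max_right _ _
    exact absurd (Real.sin_neg_of_neg_of_neg_pi_lt hm0 (by linarith)) (not_lt.2 this)
  · set m := min (D t) (Real.pi + Real.pi / 2) with hm
    have hm0 : Real.pi < m := lt_min h (by linarith)
    obtain ⟨b, hb⟩ := hex Real.pi hpi
    rw [abs_lt] at hb
    obtain ⟨x, hx⟩ := hIVT b (Set.mem_uIcc.2 (Or.inl ⟨by linarith, min_le_left _ _⟩) : m ∈ _)
    have := hs x
    rw [hx] at this
    have h2 : m ≤ Real.pi + Real.pi / 2 := min_le_right _ _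
    have h3 := Real.sin_pos_of_pos_of_lt_pi (x := m - Real.pi) (by linarith) (by linarith)
    rw [Real.sin_sub_pi] at h3
    linarith

/-- On each line Im z = ε the difference of the two argument sums lies in [0, π]; letting ε tend to
0 turns it into π times the difference of the counts. -/
theorem HalfPlaneLE.countP_roots {g f : ℝ[X]} (h : HalfPlaneLE g f)
    (hg : g.Splits) (hg0 : 0 < g.leadingCoeff) (hf : f.Splits) (hf0 : 0 < f.leadingCoeff)
    {t : ℝ} (htf : t ∉ f.roots) (htg : t ∉ g.roots) :
    g.roots.countP (t < ·) ≤ f.roots.countP (t < ·) ∧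
      f.roots.countP (t < ·) ≤ g.roots.countP (t < ·) + 1 := by
  have hpi := Real.pi_pos
  have hlim := (tendsto_argSum_nhdsGT f.roots t htf).sub (tendsto_argSum_nhdsGT g.roots t htg)
  have hmem : ((f.roots.countP (t < ·) : ℝ) * Real.pi - g.roots.countP (t < ·) * Real.pi) ∈
      Set.Icc 0 Real.pi := by
    refine isClosed_Icc.mem_of_tendsto hlim ?_
    filter_upwards [self_mem_nhdsWithin] with ε hε
    have hε' : (0 : ℝ) < ε := hε
    refine mem_Icc_zero_pi_of_sin_nonneg
      (D := fun t : ℝ => argSum f.roots ((t : ℂ) + ε * Complex.I) -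
        argSum g.roots ((t : ℂ) + ε * Complex.I))
      ((continuous_argSum _ hε').sub (continuous_argSum _ hε')) ?_ ?_ t
    · simpa using (tendsto_argSum_atTop f.roots ε).sub (tendsto_argSum_atTop g.roots ε)
    · intro s
      exact h.sin_nonneg hg hg0 hf hf0 (by simpa using hε')
  rw [← sub_mul] at hmem
  have h1 : (0 : ℝ) ≤ f.roots.countP (t < ·) - g.roots.countP (t < ·) :=
    nonneg_of_mul_nonneg_left hmem.1 hpi
  have h2 : (f.roots.countP (t < ·) - g.roots.countP (t < ·) : ℝ) ≤ 1 := by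
    by_contra hlt
    rw [not_le] at hlt
    nlinarith [hmem.2]
  constructor
  · have : (g.roots.countP (t < ·) : ℝ) ≤ f.roots.countP (t < ·) := by linarith
    exact_mod_cast this
  · have : (f.roots.countP (t < ·) : ℝ) ≤ g.roots.countP (t < ·) + 1 := by linarith
    exact_mod_cast this

/-- A multiset of reals listed in weakly decreasing order. -/
theorem Multiset.exists_antitone_enumeration (s : Multiset ℝ) :
    ∃ u : ℕ → ℝ, s = (Multiset.range s.card).map u ∧
      ∀ i j, i ≤ j → j < s.card → u j ≤ u i := by
  have hlen : (s.sort (· ≥ ·)).length = s.card := Multiset.length_sort _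
  refine ⟨fun k => (s.sort (· ≥ ·)).getD k 0, ?_, ?_⟩
  · conv_lhs => rw [← Multiset.sort_eq s (· ≥ ·)]
    rw [← Multiset.coe_range, Multiset.map_coe, ← hlen]
    congr 1
    refine List.ext_getElem (by simp) fun i h1 h2 => ?_
    rw [List.getElem_map, List.getElem_range, List.getD_eq_getElem _ _ h1]
  · intro i j hij hj
    have hs : (s.sort (· ≥ ·)).Pairwise (· ≥ ·) := Multiset.pairwise_sort _ _
    rcases hij.eq_or_lt with rfl | hlt
    · exact le_rfl
    · have hj' : j < (s.sort (· ≥ ·)).length := by omega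
      simp only [List.getD_eq_getElem _ _ hj', List.getD_eq_getElem _ _ (hlt.trans hj')]
      exact List.pairwise_iff_getElem.1 hs i j _ _ hlt

theorem countP_map_range_of_lt {n k : ℕ} {u : ℕ → ℝ}
    (hu : ∀ i j, i ≤ j → j < n → u j ≤ u i) (hk : k < n) {t : ℝ} (ht : t < u k) :
    k + 1 ≤ ((Multiset.range n).map u).countP (t < ·) := by
  rw [Multiset.countP_map]
  have hle : Multiset.range (k + 1) ≤ (Multiset.range n).filter fun i => t < u i := by
    refine Multiset.le_filter.2 ⟨Multiset.range_le.2 hk, fun i hi => ?_⟩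
    rw [Multiset.mem_range] at hi
    exact ht.trans_le (hu i k (by omega) hk)
  simpa using Multiset.card_le_card hle

theorem countP_map_range_of_le {n k : ℕ} {u : ℕ → ℝ}
    (hu : ∀ i j, i ≤ j → j < n → u j ≤ u i) {t : ℝ} (ht : k < n → u k ≤ t) :
    ((Multiset.range n).map u).countP (t < ·) ≤ k := by
  rw [Multiset.countP_map]
  have hle : (Multiset.range n).filter (fun i => t < u i) ≤ Multiset.range k := by
    refine (Multiset.le_iff_subset (Multiset.Nodup.filter _ (Multiset.nodup_range n))).2 ?_
    intro i hi
    rw [Multiset.mem_filter, Multiset.mem_range] at hi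
    rw [Multiset.mem_range]
    by_contra hki
    have h1 := hu k i (by omega) hi.1
    have h2 := ht (by omega)
    linarith [hi.2]
  simpa using Multiset.card_le_card hle

theorem HalfPlaneLE.interlaces {g f : ℝ[X]} (h : HalfPlaneLE g f)
    (hg : g.Splits) (hg0 : 0 < g.leadingCoeff) (hf : f.Splits) (hf0 : 0 < f.leadingCoeff) :
    Interlaces g f := by
  obtain ⟨u, hu, hu'⟩ := Multiset.exists_antitone_enumeration f.roots
  obtain ⟨v, hv, hv'⟩ := Multiset.exists_antitone_enumeration g.roots
  rw [← hf.natDegree_eq_card_roots] at hu hu'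
  rw [← hg.natDegree_eq_card_roots] at hv hv'
  have hfin : ((f.roots + g.roots).toFinset : Set ℝ).Finite := Finset.finite_toSet _
  have hcount : ∀ a b : ℝ, a < b → ∃ t, a < t ∧ t < b ∧
      g.roots.countP (t < ·) ≤ f.roots.countP (t < ·) ∧
      f.roots.countP (t < ·) ≤ g.roots.countP (t < ·) + 1 := by
    intro a b hab
    obtain ⟨t, ht, ht'⟩ := (Set.Ioo_infinite hab).exists_notMem_finite hfin
    simp only [Finset.mem_coe, Multiset.mem_toFinset, Multiset.mem_add, not_or] at ht'
    exact ⟨t, ht.1, ht.2, h.countP_roots hg hg0 hf hf0 ht'.1 ht'.2⟩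
  have hdeg : g.natDegree ≤ f.natDegree ∧ f.natDegree ≤ g.natDegree + 1 := by
    obtain ⟨a, ha⟩ := hfin.bddBelow
    -- To the left of all zeros the counts are the degrees.
    obtain ⟨t, -, ht, h1, h2⟩ := hcount (a - 1) a (by linarith)
    have hall : ∀ s : Multiset ℝ, s ≤ f.roots + g.roots → s.countP (t < ·) = s.card := by
      intro s hs
      rw [Multiset.countP_eq_card]
      intro x hx
      exact ht.trans_le (ha (by simpa using Multiset.mem_of_le hs hx))
    rw [hall _ (Multiset.le_add_right _ _), hall _ (Multiset.le_add_left _ _),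
      ← hf.natDegree_eq_card_roots, ← hg.natDegree_eq_card_roots] at h1 h2
    exact ⟨h1, h2⟩
  refine ⟨⟨hg0, hg⟩, ⟨hf0, hf⟩, by omega, u, v, hu, hv, ?_, ?_⟩
  · intro k hk
    -- If u k < v k, a point t between them has at least k + 1 zeros of g but at most k zeros of f
    -- to its right.
    by_contra hlt
    obtain ⟨t, h1, h2, h3, -⟩ := hcount _ _ (not_le.1 hlt)
    rw [hu, hv] at h3
    have h5 := countP_map_range_of_lt hv' hk h2
    have h6 := countP_map_range_of_le hu' (k := k) fun _ => h1.le
    omega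
  · intro k hk
    by_contra hlt
    obtain ⟨t, h1, h2, -, h4⟩ := hcount _ _ (not_le.1 hlt)
    rw [hu, hv] at h4
    have h5 := countP_map_range_of_lt hu' hk h2
    have h6 := countP_map_range_of_le hv' (k := k) fun _ => h1.le
    omega

/-- A real polynomial without zeros in the open upper half-plane has only real zeros. -/
theorem splits_of_aeval_ne_zero {f : ℝ[X]}
    (h : ∀ z : ℂ, 0 < z.im → aeval z f ≠ 0) : f.Splits := by
  refine Splits.of_splits_map (algebraMap ℝ ℂ) (IsAlgClosed.splits _) fun z hz => ?_
  have h0 : aeval z f = 0 := by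
    have := (mem_roots'.1 hz).2
    rwa [IsRoot.def, eval_map_algebraMap] at this
  rcases lt_trichotomy z.im 0 with hlt | he | hgt
  · refine absurd ?_ (h ((starRingEnd ℂ) z) (by simpa using hlt))
    rw [aeval_conj, h0, map_zero]
  · exact ⟨z.re, Complex.ext (by simp) (by simp [he])⟩
  · exact absurd h0 (h z hgt)

/-! ### Sector-ordered families of complex numbers -/

/-- The numbers `w 0, …, w (m - 1)` are nonzero, with arguments weakly increasing within a sector
whose angle is the argument of `z`. -/
structure SectorOrdered (z : ℂ) (m : ℕ) (w : ℕ → ℂ) : Prop where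
  ne_zero : ∀ k < m, w k ≠ 0
  im_nonneg : ∀ k l, k < l → l < m → 0 ≤ (w l * (starRingEnd ℂ) (w k)).im
  im_mul_nonneg : ∀ k l, k < l → l < m → 0 ≤ (z * w k * (starRingEnd ℂ) (w l)).im

theorem Complex.im_mul_conj_self_eq_zero (w : ℂ) : (w * (starRingEnd ℂ) w).im = 0 := by
  rw [Complex.mul_conj, Complex.ofReal_im]

theorem im_mul_mul_conj_self (z w : ℂ) :
    (z * w * (starRingEnd ℂ) w).im = z.im * Complex.normSq w := by
  rw [mul_assoc, Complex.mul_conj, Complex.im_mul_ofReal]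

theorem im_sum_mul_conj_sum_nonneg {s t : Finset ℕ} {w : ℕ → ℂ} (c : ℂ)
    (h : ∀ l ∈ s, ∀ k ∈ t, 0 ≤ (c * w l * (starRingEnd ℂ) (w k)).im) :
    0 ≤ (c * (∑ l ∈ s, w l) * (starRingEnd ℂ) (∑ k ∈ t, w k)).im := by
  rw [map_sum, Finset.mul_sum s, Finset.sum_mul_sum, Complex.im_sum]
  refine Finset.sum_nonneg fun l hl => ?_
  rw [Complex.im_sum]
  exact Finset.sum_nonneg fun k hk => h l hl k hk

/-- For k the least index in s, every term lies in the closed half-plane of those w with Im(z · w k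
· conj w) ≥ 0, and w k itself lies in its interior. -/
theorem SectorOrdered.sum_ne_zero {z : ℂ} (hz : 0 < z.im) {m : ℕ} {w : ℕ → ℂ}
    (h : SectorOrdered z m w) {s : Finset ℕ} (hs : s ⊆ Finset.range m) (hne : s.Nonempty) :
    ∑ l ∈ s, w l ≠ 0 := by
  intro h0
  have hk := s.min'_mem hne
  set k := s.min' hne with hkdef
  have h1 : (z * w k * (starRingEnd ℂ) (∑ l ∈ s, w l)).im = 0 := by simp [h0]
  rw [map_sum, Finset.mul_sum, Complex.im_sum] at h1
  have hkm := Finset.mem_range.1 (hs hk)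
  have h2 : (0 : ℝ) < ∑ l ∈ s, (z * w k * (starRingEnd ℂ) (w l)).im := by
    refine Finset.sum_pos' (fun l hl => ?_) ⟨k, hk, ?_⟩
    · rcases (s.min'_le l hl).eq_or_lt with he | hlt
      · rw [← he, im_mul_mul_conj_self]
        exact mul_nonneg hz.le (Complex.normSq_nonneg _)
      · exact h.im_mul_nonneg k l hlt (Finset.mem_range.1 (hs hl))
    · rw [im_mul_mul_conj_self]
      exact mul_pos hz (Complex.normSq_pos.2 (h.ne_zero k hkm))
  linarith

/-- Positive factors do not move arguments, and a repeated term is harmless because Im(w · conj w) =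
0 and Im(z · w · conj w) ≥ 0. -/
theorem SectorOrdered.smul_comp {z : ℂ} {m m' : ℕ} {w : ℕ → ℂ} (hz : 0 < z.im)
    (h : SectorOrdered z m w)
    {τ : ℕ → ℕ} (hτ : Monotone τ) (hm : ∀ i < m', τ i < m) {c : ℕ → ℝ} (hc : ∀ i < m', 0 < c i)
    {w' : ℕ → ℂ} (hw : ∀ i < m', w' i = c i * w (τ i)) : SectorOrdered z m' w' := by
  have key : ∀ a k l, k < m' → l < m' → (a * w' k * (starRingEnd ℂ) (w' l)).im =
      c k * c l * (a * w (τ k) * (starRingEnd ℂ) (w (τ l))).im := by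
    intro a k l hk hl
    rw [hw k hk, hw l hl, map_mul, Complex.conj_ofReal, ← Complex.im_ofReal_mul]
    congr 1
    push_cast
    ring
  refine ⟨fun k hk => ?_, fun k l hkl hl => ?_, fun k l hkl hl => ?_⟩
  · rw [hw k hk]
    exact mul_ne_zero (by exact_mod_cast (hc k hk).ne') (h.ne_zero _ (hm k hk))
  · have hk := hkl.trans hl
    have := key 1 l k hl hk
    rw [one_mul, one_mul] at this
    rw [this]
    refine mul_nonneg (mul_pos (hc l hl) (hc k hk)).le ?_
    rcases (hτ hkl.le).eq_or_lt with he | hlt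
    · rw [he, Complex.im_mul_conj_self_eq_zero]
    · exact h.im_nonneg _ _ hlt (hm l hl)
  · have hk := hkl.trans hl
    rw [key z k l hk hl]
    refine mul_nonneg (mul_pos (hc k hk) (hc l hl)).le ?_
    rcases (hτ hkl.le).eq_or_lt with he | hlt
    · rw [he, im_mul_mul_conj_self]
      exact mul_nonneg hz.le (Complex.normSq_nonneg _)
    · exact h.im_mul_nonneg _ _ hlt (hm l hl)

/-- Sums in which an initial segment of the terms is multiplied by `z` inherit
`SectorOrdered`. -/
theorem SectorOrdered.transform {z : ℂ} (hz : 0 < z.im) {m m' : ℕ} (hm : 0 < m) {w : ℕ → ℂ}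
    (h : SectorOrdered z m w) {p : ℕ → ℕ → Prop} [∀ i l, Decidable (p i l)]
    (hpl : ∀ i l l', l ≤ l' → p i l' → p i l) (hpi : ∀ i i' l, i ≤ i' → p i l → p i' l)
    {w' : ℕ → ℂ}
    (hw : ∀ i < m', w' i = ∑ l ∈ Finset.range m, (if p i l then z else 1) * w l) :
    SectorOrdered z m' w' := by
  have hlt : ∀ i l l', p i l → ¬ p i l' → l < l' := fun i l l' h1 h2 =>
    not_le.1 fun hle => h2 (hpl i l' l hle h1)
  have nn : ∀ l k, k < l → l < m → 0 ≤ ((1 : ℂ) * w l * (starRingEnd ℂ) (w k)).im := by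
    intro l k hkl hl
    rw [one_mul]
    exact h.im_nonneg k l hkl hl
  have split1 : ∀ i < m', w' i = z * (∑ l ∈ (Finset.range m).filter (p i ·), w l) +
      ∑ l ∈ (Finset.range m).filter (¬ p i ·), w l := by
    intro i hi
    rw [hw i hi, ← Finset.sum_filter_add_sum_filter_not _ (p i ·), Finset.mul_sum]
    congr 1
    · exact Finset.sum_congr rfl fun l hl => by rw [if_pos (Finset.mem_filter.1 hl).2]
    · exact Finset.sum_congr rfl fun l hl => by rw [if_neg (Finset.mem_filter.1 hl).2, one_mul]
  -- The index range splits into three consecutive blocks with sums a, b, c: terms multiplied by z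
  -- in both sums, only in the j-th, and in neither.
  have main : ∀ i j, i < j → j < m' → ∃ a b c : ℂ,
      w' i = z * a + b + c ∧ w' j = z * a + z * b + c ∧
      0 ≤ (b * (starRingEnd ℂ) a).im ∧ 0 ≤ (c * (starRingEnd ℂ) b).im ∧
      0 ≤ (z * a * (starRingEnd ℂ) b).im ∧ 0 ≤ (z * b * (starRingEnd ℂ) c).im := by
    intro i j hij hj
    refine ⟨∑ l ∈ (Finset.range m).filter (p i ·), w l,
      ∑ l ∈ (Finset.range m).filter (fun l => ¬ p i l ∧ p j l), w l,
      ∑ l ∈ (Finset.range m).filter (¬ p j ·), w l, ?_, ?_, ?_, ?_, ?_, ?_⟩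
    · rw [split1 i (hij.trans hj), add_assoc]
      congr 1
      rw [← Finset.sum_filter_add_sum_filter_not _ (p j ·), Finset.filter_filter,
        Finset.filter_filter]
      congr 1
      refine Finset.sum_congr (Finset.filter_congr fun l _ => ?_) fun _ _ => rfl
      exact ⟨fun hh => hh.2, fun hh => ⟨fun h1 => hh (hpi i j l hij.le h1), hh⟩⟩
    · rw [split1 j hj]
      congr 1
      rw [← mul_add, ← Finset.sum_filter_add_sum_filter_not
        ((Finset.range m).filter (p j ·)) (p i ·), Finset.filter_filter, Finset.filter_filter]
      congr 2
      · refine Finset.sum_congr (Finset.filter_congr fun l _ => ?_) fun _ _ => rfl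
        exact ⟨fun hh => hh.2, fun hh => ⟨hpi i j l hij.le hh, hh⟩⟩
      · refine Finset.sum_congr (Finset.filter_congr fun l _ => ?_) fun _ _ => rfl
        exact and_comm
    · have := im_sum_mul_conj_sum_nonneg (w := w)
        (s := (Finset.range m).filter (fun l => ¬ p i l ∧ p j l))
        (t := (Finset.range m).filter (p i ·)) 1 (fun l hl k hk => by
          simp only [Finset.mem_filter, Finset.mem_range] at hl hk
          exact nn l k (hlt i k l hk.2 hl.2.1) hl.1)
      rwa [one_mul] at this
    · have := im_sum_mul_conj_sum_nonneg (w := w)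
        (s := (Finset.range m).filter (¬ p j ·))
        (t := (Finset.range m).filter (fun l => ¬ p i l ∧ p j l)) 1 (fun l hl k hk => by
          simp only [Finset.mem_filter, Finset.mem_range] at hl hk
          exact nn l k (hlt j k l hk.2.2 hl.2) hl.1)
      rwa [one_mul] at this
    · refine im_sum_mul_conj_sum_nonneg z fun l hl k hk => ?_
      simp only [Finset.mem_filter, Finset.mem_range] at hl hk
      exact h.im_mul_nonneg l k (hlt i l k hl.2 hk.2.1) hk.1
    · refine im_sum_mul_conj_sum_nonneg z fun l hl k hk => ?_
      simp only [Finset.mem_filter, Finset.mem_range] at hl hk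
      exact h.im_mul_nonneg l k (hlt j l k hl.2.2 hk.2) hk.1
  refine ⟨fun i hi h0 => ?_, fun i j hij hj => ?_, fun i j hij hj => ?_⟩
  · rw [split1 i hi] at h0
    have hle : 0 ≤ ((∑ l ∈ (Finset.range m).filter (¬ p i ·), w l) *
        (starRingEnd ℂ) (∑ l ∈ (Finset.range m).filter (p i ·), w l)).im := by
      have := im_sum_mul_conj_sum_nonneg (w := w)
        (s := (Finset.range m).filter (¬ p i ·))
        (t := (Finset.range m).filter (p i ·)) 1 (fun l hl k hk => by
          simp only [Finset.mem_filter, Finset.mem_range] at hl hk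
          exact nn l k (hlt i k l hk.2 hl.2) hl.1)
      rwa [one_mul] at this
    -- If z a + c = 0, then Im(c · conj a) = -Im z · |a|², which forces a = 0; hence the first block
    -- is empty and c is the full sum, which is nonzero.
    rw [add_eq_zero_iff_neg_eq.1 h0 |>.symm, neg_mul, Complex.neg_im, im_mul_mul_conj_self] at hle
    have hE : (Finset.range m).filter (p i ·) = ∅ := by
      by_contra hne
      have := h.sum_ne_zero hz (Finset.filter_subset (p i ·) (Finset.range m))
        (Finset.nonempty_iff_ne_empty.2 hne)
      have := mul_pos hz (Complex.normSq_pos.2 this)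
      linarith
    have hE' : (Finset.range m).filter (¬ p i ·) = Finset.range m := by
      rw [Finset.filter_eq_empty_iff] at hE
      rw [Finset.filter_eq_self]
      exact fun l hl => hE hl
    rw [hE, hE', Finset.sum_empty, mul_zero, zero_add] at h0
    exact h.sum_ne_zero hz subset_rfl (Finset.nonempty_range_iff.2 hm.ne') h0
  · obtain ⟨a, b, c, hi, hj, h1, h2, h3, h4⟩ := main i j hij hj
    -- The common part z a + c contributes a real square, so no relation between a and c is needed.
    have e : (w' j * (starRingEnd ℂ) (w' i)).im =
        Complex.normSq z * (b * (starRingEnd ℂ) a).im + (z * a * (starRingEnd ℂ) b).im +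
        (c * (starRingEnd ℂ) b).im + (z * b * (starRingEnd ℂ) c).im +
        z.im * Complex.normSq b := by
      rw [hi, hj]
      simp [Complex.normSq_apply]
      ring
    rw [e]
    have := Complex.normSq_nonneg z
    have := Complex.normSq_nonneg b
    have := hz.le
    positivity
  · obtain ⟨a, b, c, hi, hj, h1, h2, h3, h4⟩ := main i j hij hj
    have e : (z * w' i * (starRingEnd ℂ) (w' j)).im =
        z.im * Complex.normSq (z * a + c) +
        Complex.normSq z * ((z * a * (starRingEnd ℂ) b).im + (c * (starRingEnd ℂ) b).im +
          (b * (starRingEnd ℂ) a).im) + (z * b * (starRingEnd ℂ) c).im := by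
      rw [hi, hj]
      simp [Complex.normSq_apply]
      ring
    rw [e]
    have := Complex.normSq_nonneg z
    have := Complex.normSq_nonneg (z * a + c)
    have := hz.le
    positivity

/-! ### The recursion obtained by appending an entry -/

namespace InversionSeq

variable {n : ℕ}

/-- Appending an entry to a `(2, 4, 6, …)`-inversion sequence. -/
def snoc (e : InversionSeq evenSeq n) (a : Fin (evenSeq (n + 1))) :
    InversionSeq evenSeq (n + 1) :=
  Fin.snoc (α := fun k : Fin (n + 1) => Fin (evenSeq (k.val + 1))) e a

theorem entry_snoc_last (e : InversionSeq evenSeq n) (a : Fin (evenSeq (n + 1))) :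
    (snoc e a).entry (n + 1) = a := by
  unfold entry snoc
  rw [dif_pos ⟨by omega, le_rfl⟩]
  exact congrArg Fin.val (Fin.snoc_last
    (α := fun k : Fin (n + 1) => Fin (evenSeq (k.val + 1))) a e)

theorem entry_snoc_of_le (e : InversionSeq evenSeq n) (a : Fin (evenSeq (n + 1))) {k : ℕ}
    (hk : k ≤ n) : (snoc e a).entry k = e.entry k := by
  unfold entry snoc
  by_cases h : 1 ≤ k
  · rw [dif_pos ⟨h, by omega⟩, dif_pos ⟨h, hk⟩]
    exact congrArg Fin.val (Fin.snoc_castSucc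
      (α := fun k : Fin (n + 1) => Fin (evenSeq (k.val + 1))) a e ⟨k - 1, by omega⟩)
  · rw [dif_neg (by omega), dif_neg (by omega)]

theorem entry_lt (e : InversionSeq evenSeq n) (hn : 1 ≤ n) : e.entry n < 2 * n := by
  unfold entry
  rw [dif_pos ⟨hn, le_rfl⟩]
  refine (Fin.is_lt _).trans_le ?_
  simp only [evenSeq]
  omega

theorem sum_eq_sum_snoc {M : Type*} [AddCommMonoid M] (F : InversionSeq evenSeq (n + 1) → M) :
    ∑ e, F e = ∑ e : InversionSeq evenSeq n, ∑ a : Fin (evenSeq (n + 1)), F (snoc e a) := by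
  rw [← (Fin.snocEquiv fun k : Fin (n + 1) => Fin (evenSeq (k.val + 1))).sum_comp,
    Fintype.sum_prod_type, Finset.sum_comm]
  rfl

end InversionSeq

theorem exc_snoc {n : ℕ} (e : InversionSeq evenSeq n) (a : Fin (evenSeq (n + 1))) :
    exc (e.snoc a) = exc e + if n + 1 ≤ a.val then 1 else 0 := by
  unfold exc
  rw [← Finset.insert_Icc_right_eq_Icc_add_one (by omega), Finset.filter_insert,
    e.entry_snoc_last]
  have h : (Finset.Icc 1 n).filter (fun k => k ≤ (e.snoc a).entry k) =
      (Finset.Icc 1 n).filter fun k => k ≤ e.entry k :=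
    Finset.filter_congr fun k hk => by rw [e.entry_snoc_of_le a (Finset.mem_Icc.1 hk).2]
  split_ifs
  · rw [Finset.card_insert_of_notMem (by simp), h]
  · rw [h, add_zero]

/-- The ascent at 0 depends only on the first two entries, so from length 2 on an appended entry can
only create an ascent at n. -/
theorem ascD_snoc {n : ℕ} (hn : 2 ≤ n) (e : InversionSeq evenSeq n)
    (a : Fin (evenSeq (n + 1))) :
    ascD (e.snoc a) =
      ascD e + if (e.entry n : ℚ) / n < (a.val : ℚ) / ((n : ℚ) + 1) then 1 else 0 := by
  obtain ⟨m, rfl⟩ : ∃ m, n = m + 1 := ⟨n - 1, by omega⟩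
  unfold ascD AscD
  simp only [Nat.add_sub_cancel]
  rw [e.entry_snoc_of_le a (k := 1) (by omega), e.entry_snoc_of_le a (k := 2) (by omega),
    ← Finset.insert_Icc_right_eq_Icc_add_one (b := m) (by omega), Finset.filter_insert,
    e.entry_snoc_last, e.entry_snoc_of_le a le_rfl]
  have h : (Finset.Icc 1 m).filter (fun k => ((e.snoc a).entry k : ℚ) / (k : ℚ) <
        ((e.snoc a).entry (k + 1) : ℚ) / ((k : ℚ) + 1)) =
      (Finset.Icc 1 m).filter fun k => (e.entry k : ℚ) / (k : ℚ) <
        (e.entry (k + 1) : ℚ) / ((k : ℚ) + 1) :=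
    Finset.filter_congr fun k hk => by
      have := (Finset.mem_Icc.1 hk).2
      rw [e.entry_snoc_of_le a (by omega), e.entry_snoc_of_le a (by omega)]
  rw [h]
  split_ifs <;> first
    | rw [Finset.insert_union, Finset.card_insert_of_notMem (by simp)]
    | rw [add_zero]

/-- The refined Eulerian polynomials of length `n + 1` in terms of those of length `n`. -/
theorem refinedEulerianD_succ {n i : ℕ} (hn : 2 ≤ n) (hi : i < 2 * (n + 1)) (q : ℝ) :
    refinedEulerianD (n + 1) i q = C (if n + 1 ≤ i then q else 1) *
      ∑ l ∈ Finset.range (2 * n),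
        (if (l : ℚ) / n < (i : ℚ) / ((n : ℚ) + 1) then X else 1) * refinedEulerianD n l q := by
  unfold refinedEulerianD
  rw [InversionSeq.sum_eq_sum_snoc]
  simp only [Finset.mul_sum]
  rw [Finset.sum_comm (s := Finset.range _)]
  refine Finset.sum_congr rfl fun e _ => ?_
  rw [Finset.sum_eq_single (⟨i, hi⟩ : Fin (evenSeq (n + 1)))]
  · rw [Finset.sum_eq_single (e.entry n)]
    · rw [if_pos (e.entry_snoc_last _), if_pos rfl, exc_snoc, ascD_snoc hn]
      simp only
      split_ifs <;> simp [pow_add] <;> ring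
    · intro l _ hl
      rw [if_neg (Ne.symm hl), mul_zero, mul_zero]
    · intro h
      exact absurd (Finset.mem_range.2 (e.entry_lt (by omega))) h
  · intro a _ ha
    rw [if_neg]
    rw [e.entry_snoc_last]
    exact fun h => ha (Fin.ext h)
  · intro h
    exact absurd (Finset.mem_univ _) h

theorem refinedEulerianD_two (q : ℝ) :
    refinedEulerianD 2 0 q = C (1 + q) ∧ refinedEulerianD 2 1 q = C (1 + q) * X ∧
    refinedEulerianD 2 2 q = C (q * (1 + q)) * X ∧
    refinedEulerianD 2 3 q = C (q * (1 + q)) * X ^ 2 := by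
  have h : ∀ F : InversionSeq evenSeq 2 → ℝ[X], ∑ e, F e =
      ∑ a : Fin 2, ∑ b : Fin 4,
        F (InversionSeq.snoc (n := 1) (InversionSeq.snoc (n := 0) (fun k => k.elim0) a) b) := by
    intro F
    rw [InversionSeq.sum_eq_sum_snoc, InversionSeq.sum_eq_sum_snoc, Fintype.sum_unique]
    rfl
  -- In length 2 the number of type D ascents is independent of the first entry, although the ascent
  -- set is not.
  have hasc : ∀ a : Fin 2, ∀ b : Fin 4,
      ascD (InversionSeq.snoc (n := 1) (InversionSeq.snoc (n := 0) (fun k => k.elim0) a) b) =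
        ![0, 1, 1, 2] b := by decide +kernel
  have hexc : ∀ a : Fin 2, ∀ b : Fin 4,
      exc (InversionSeq.snoc (n := 1) (InversionSeq.snoc (n := 0) (fun k => k.elim0) a) b) =
        ![0, 1] a + ![0, 0, 1, 1] b := by decide
  have hlast : ∀ a : Fin 2, ∀ b : Fin 4,
      (InversionSeq.snoc (n := 1) (InversionSeq.snoc (n := 0) (fun k => k.elim0) a) b).entry 2 =
        b := by decide
  unfold refinedEulerianD
  simp only [h, hasc, hexc, hlast]
  refine ⟨?_, ?_, ?_, ?_⟩ <;> simp [Fin.sum_univ_succ] <;> ring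

/-! ### Bézout forms and positivity -/

/-- If the leading principal minors of the Bézout matrix of two real cubics are nonnegative, the
first two of them strictly, then the cubics are ordered on the upper half-plane. -/
theorem im_cubic_mul_conj_cubic {f₀ f₁ f₂ f₃ g₀ g₁ g₂ g₃ m₀₀ m₀₁ m₀₂ m₁₁ m₁₂ m₂₂ : ℝ}
    (e₀₀ : f₁ * g₀ - f₀ * g₁ = m₀₀) (e₀₁ : f₂ * g₀ - f₀ * g₂ = m₀₁)
    (e₀₂ : f₃ * g₀ - f₀ * g₃ = m₀₂) (e₁₁ : f₂ * g₁ - f₁ * g₂ + m₀₂ = m₁₁)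
    (e₁₂ : f₃ * g₁ - f₁ * g₃ = m₁₂) (e₂₂ : f₃ * g₂ - f₂ * g₃ = m₂₂)
    (h₁ : 0 < m₀₀) (h₂ : 0 < m₀₀ * m₁₁ - m₀₁ ^ 2)
    (h₃ : 0 ≤ (m₀₀ * m₁₁ - m₀₁ ^ 2) * (m₀₀ * m₂₂ - m₀₂ ^ 2) - (m₀₀ * m₁₂ - m₀₁ * m₀₂) ^ 2)
    {z : ℂ} (hz : 0 < z.im) :
    0 ≤ ((f₀ + f₁ * z + f₂ * z ^ 2 + f₃ * z ^ 3) *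
      (starRingEnd ℂ) (g₀ + g₁ * z + g₂ * z ^ 2 + g₃ * z ^ 3)).im ∧
    (0 < (m₀₀ * m₁₁ - m₀₁ ^ 2) * (m₀₀ * m₂₂ - m₀₂ ^ 2) - (m₀₀ * m₁₂ - m₀₁ * m₀₂) ^ 2 →
      f₀ + f₁ * z + f₂ * z ^ 2 + f₃ * z ^ 3 ≠ 0) := by
  set Δ := m₀₀ * m₁₁ - m₀₁ ^ 2 with hΔ
  set E := m₀₀ * m₁₂ - m₀₁ * m₀₂ with hE
  set G := Δ * (m₀₀ * m₂₂ - m₀₂ ^ 2) - E ^ 2 with hG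
  -- The imaginary part is Im z times the Hermitian Bézout form at (1, z, z²). Completing squares
  -- gives Δ|m₀₀ + m₀₁ z + m₀₂ z²|² + |Δ z + E z²|² + G|z²|², and by Sylvester's identity G is m₀₀
  -- times the full determinant.
  have key : m₀₀ * Δ * ((f₀ + f₁ * z + f₂ * z ^ 2 + f₃ * z ^ 3) *
      (starRingEnd ℂ) (g₀ + g₁ * z + g₂ * z ^ 2 + g₃ * z ^ 3)).im =
      z.im * (Δ * (m₀₀ + m₀₁ * z.re + m₀₂ * (z.re ^ 2 - z.im ^ 2)) ^ 2 +
        (Δ * z.re + E * (z.re ^ 2 - z.im ^ 2)) ^ 2 +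
        Δ * (m₀₁ * z.im + m₀₂ * (2 * z.re * z.im)) ^ 2 +
        (Δ * z.im + E * (2 * z.re * z.im)) ^ 2 +
        G * (z.re ^ 2 + z.im ^ 2) ^ 2) := by
    obtain ⟨x, y⟩ := z
    have hform : ((f₀ + f₁ * (⟨x, y⟩ : ℂ) + f₂ * (⟨x, y⟩ : ℂ) ^ 2 + f₃ * (⟨x, y⟩ : ℂ) ^ 3) *
        (starRingEnd ℂ) (g₀ + g₁ * (⟨x, y⟩ : ℂ) + g₂ * (⟨x, y⟩ : ℂ) ^ 2 +
          g₃ * (⟨x, y⟩ : ℂ) ^ 3)).im =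
        y * (m₀₀ + 2 * m₀₁ * x + 2 * m₀₂ * (x ^ 2 - y ^ 2) + m₁₁ * (x ^ 2 + y ^ 2) +
          2 * m₁₂ * x * (x ^ 2 + y ^ 2) + m₂₂ * (x ^ 2 + y ^ 2) ^ 2) := by
      rw [← e₁₁, ← e₀₀, ← e₀₁, ← e₀₂, ← e₁₂, ← e₂₂]
      simp [pow_succ]
      ring
    rw [hform, hG, hE, hΔ]
    ring
  have hpos := mul_pos h₁ h₂
  constructor
  · refine nonneg_of_mul_nonneg_right (key ▸ ?_) hpos
    have := hz.le
    have := h₂.le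
    positivity
  · intro h₄ h0
    rw [h0, zero_mul, Complex.zero_im, mul_zero] at key
    have := h₂.le
    have h5 : 0 < z.im * (Δ * (m₀₀ + m₀₁ * z.re + m₀₂ * (z.re ^ 2 - z.im ^ 2)) ^ 2 +
        (Δ * z.re + E * (z.re ^ 2 - z.im ^ 2)) ^ 2 +
        Δ * (m₀₁ * z.im + m₀₂ * (2 * z.re * z.im)) ^ 2 +
        (Δ * z.im + E * (2 * z.re * z.im)) ^ 2 +
        G * (z.re ^ 2 + z.im ^ 2) ^ 2) := by
      positivity
    linarith

/-- Completing the square in the 2 × 2 Bézout form, after multiplication by its first entry. -/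
theorem im_quadratic_mul_conj_quadratic {f₀ f₁ f₂ g₀ g₁ g₂ : ℝ}
    (h₁ : 0 < f₁ * g₀ - f₀ * g₁)
    (h₂ : 0 ≤ (f₁ * g₀ - f₀ * g₁) * (f₂ * g₁ - f₁ * g₂) - (f₂ * g₀ - f₀ * g₂) ^ 2)
    {z : ℂ} (hz : 0 < z.im) :
    0 ≤ ((f₀ + f₁ * z + f₂ * z ^ 2) * (starRingEnd ℂ) (g₀ + g₁ * z + g₂ * z ^ 2)).im := by
  refine nonneg_of_mul_nonneg_right (le_of_le_of_eq (b := z.im *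
    ((f₁ * g₀ - f₀ * g₁ + (f₂ * g₀ - f₀ * g₂) * z.re) ^ 2 +
      ((f₂ * g₀ - f₀ * g₂) * z.im) ^ 2 +
      ((f₁ * g₀ - f₀ * g₁) * (f₂ * g₁ - f₁ * g₂) - (f₂ * g₀ - f₀ * g₂) ^ 2) *
        (z.re ^ 2 + z.im ^ 2))) ?_ ?_) h₁
  · have := hz.le
    positivity
  · simp [pow_succ]
    ring

/-- A nonreal zero has real part -b/(2a), and then b² - 4ac = -4a²(Im z)² < 0. -/
theorem quadratic_ne_zero {a b c : ℝ} (ha : 0 < a) (h : 4 * a * c < b ^ 2) {z : ℂ}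
    (hz : 0 < z.im) : (c + b * z + a * z ^ 2 : ℂ) ≠ 0 := by
  intro h0
  have hre := congrArg Complex.re h0
  have him := congrArg Complex.im h0
  simp [pow_two] at hre him
  have h1 : b + 2 * a * z.re = 0 := by
    have : z.im * (b + 2 * a * z.re) = 0 := by linarith
    exact (mul_eq_zero.1 this).resolve_left hz.ne'
  have h2 : b = -(2 * a * z.re) := by linarith
  rw [h2] at hre h
  have := mul_pos (mul_pos ha ha) (mul_pos hz hz)
  nlinarith [congrArg (a * ·) hre]

/-! ### The base case: the polynomials of length 4 -/

section

variable (q : ℝ)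

/-- Up to positive factors, the polynomials `T_{4,i} / X` for `i = 1, 2, 3, 5, 6` are
quadratic, with these coefficients. -/
def midCoeff : Fin 5 → Fin 3 → ℝ :=
  ![![4 + q, 2 + 4 * q, q],
    ![2 + 4 * q + q ^ 2, 4 + 6 * q + 4 * q ^ 2, 2 * q + q ^ 2],
    ![1 + 3 * q + q ^ 2, 4 + 6 * q + 4 * q ^ 2, 1 + 3 * q + q ^ 2],
    ![1 + 2 * q, 4 + 6 * q + 4 * q ^ 2, 1 + 4 * q + 2 * q ^ 2],
    ![1, 4 + 2 * q, 1 + 4 * q]]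

noncomputable def midValue (z : ℂ) (j : Fin 5) : ℂ :=
  midCoeff q j 0 + midCoeff q j 1 * z + midCoeff q j 2 * z ^ 2

/-- The value of `T_{4,0}`. -/
noncomputable def endValue (z : ℂ) : ℂ :=
  (1 : ℝ) + (4 + 6 * q + q ^ 2 : ℝ) * z + (1 + 6 * q + 4 * q ^ 2 : ℝ) * z ^ 2 +
    (q ^ 2 : ℝ) * z ^ 3

variable {q} {z : ℂ}

theorem midValue_ne_zero (hq : 0 < q) (hz : 0 < z.im) (j : Fin 5) : midValue q z j ≠ 0 := by
  refine quadratic_ne_zero ?_ ?_ hz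
  · fin_cases j <;> simp [midCoeff, -sub_pos, -sub_nonneg] <;> positivity
  · rw [← sub_pos]
    fin_cases j <;> simp [midCoeff, -sub_pos, -sub_nonneg] <;> ring_nf <;> positivity

theorem im_midValue_mul_conj_midValue (hq : 0 < q) (hz : 0 < z.im) {i j : Fin 5} (hij : i < j) :
    0 ≤ (midValue q z j * (starRingEnd ℂ) (midValue q z i)).im := by
  refine im_quadratic_mul_conj_quadratic ?_ ?_ hz
  · revert hij
    fin_cases i <;> fin_cases j <;> simp [midCoeff, -sub_pos, -sub_nonneg] <;> ring_nf <;>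
      positivity
  · revert hij
    fin_cases i <;> fin_cases j <;> simp [midCoeff, -sub_pos, -sub_nonneg] <;> first
      | (ring_nf; positivity)
      -- The pair (0, 4): at q = 1 both quadratics vanish at -1, so the determinant, a resultant up
      -- to sign, has a zero there and its coefficients cannot all be positive.
      | exact le_of_le_of_eq (b := 12 * (1 - q ^ 2) ^ 2) (by positivity) (by ring1)

theorem im_mul_midValue_mul_conj_midValue (hq : 0 < q) (hz : 0 < z.im) {i j : Fin 5}
    (hij : i < j) : 0 ≤ (z * midValue q z i * (starRingEnd ℂ) (midValue q z j)).im := by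
  have h := (im_cubic_mul_conj_cubic (f₀ := 0) (f₁ := midCoeff q i 0)
    (f₂ := midCoeff q i 1) (f₃ := midCoeff q i 2) (g₀ := midCoeff q j 0) (g₁ := midCoeff q j 1)
    (g₂ := midCoeff q j 2) (g₃ := 0) rfl rfl rfl rfl rfl rfl ?_ ?_ ?_ hz).1
  · convert h using 3
    · simp [midValue]; ring
    · simp [midValue]
  · revert hij
    fin_cases i <;> fin_cases j <;> simp [midCoeff, -sub_pos, -sub_nonneg] <;> ring_nf <;>
      positivity
  · revert hij
    fin_cases i <;> fin_cases j <;> simp [midCoeff, -sub_pos, -sub_nonneg] <;> ring_nf <;>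
      positivity
  · revert hij
    fin_cases i <;> fin_cases j <;> simp [midCoeff, -sub_pos, -sub_nonneg] <;> first
      | (ring_nf; positivity)
      | exact le_of_le_of_eq (b := 12 * q * (1 - q ^ 2) ^ 2 * (4 + q)) (by positivity) (by ring1)

/-- The middle quadratic serves as a comparison because its Bézout determinant with the cubic is
strictly positive for all q > 0; against quadratics 0 and 4 the determinant vanishes at q = 1. -/
theorem endValue_ne_zero (hq : 0 < q) (hz : 0 < z.im) : endValue q z ≠ 0 := by
  refine (im_cubic_mul_conj_cubic (g₀ := midCoeff q 2 0) (g₁ := midCoeff q 2 1)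
    (g₂ := midCoeff q 2 2) (g₃ := 0) rfl rfl rfl rfl rfl rfl ?_ ?_ ?_ hz).2 ?_ <;>
  simp [midCoeff, -sub_pos, -sub_nonneg] <;> ring_nf <;> positivity

theorem im_endValue_mul_conj_midValue (hq : 0 < q) (hz : 0 < z.im) (j : Fin 5) :
    0 ≤ (endValue q z * (starRingEnd ℂ) (midValue q z j)).im := by
  have h := (im_cubic_mul_conj_cubic (f₀ := 1) (f₁ := 4 + 6 * q + q ^ 2)
    (f₂ := 1 + 6 * q + 4 * q ^ 2) (f₃ := q ^ 2) (g₀ := midCoeff q j 0) (g₁ := midCoeff q j 1)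
    (g₂ := midCoeff q j 2) (g₃ := 0) rfl rfl rfl rfl rfl rfl ?_ ?_ ?_ hz).1
  · simpa [midValue, endValue] using h
  · fin_cases j <;> simp [midCoeff, -sub_pos, -sub_nonneg] <;> ring_nf <;> positivity
  · fin_cases j <;> simp [midCoeff, -sub_pos, -sub_nonneg] <;> first
      | (ring_nf; positivity)
      -- For j = 0 the minor is 12 + 24q - 24q² - 22q³ + 20q⁴ + 14q⁵; the squares absorb the
      -- negative terms.
      | exact lt_of_lt_of_eq (b := 12 * (1 - q ^ 2) ^ 2 +
          q * (14 * (q ^ 2 - 11 / 14) ^ 2 + 8 * q ^ 3 + 215 / 14)) (by positivity) (by ring1)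
  · fin_cases j <;> simp [midCoeff, -sub_pos, -sub_nonneg] <;> first
      | (ring_nf; positivity)
      -- For j = 0 and j = 4 the cubic shares the zero -1 with the quadratic at q = 1.
      | exact le_of_le_of_eq (b := 12 * q ^ 3 * (1 - q ^ 2) ^ 2 *
          (14 + 24 * q + 10 * q ^ 2 + q ^ 3)) (by positivity) (by ring1)
      | exact le_of_le_of_eq (b := 12 * q ^ 5 * (1 - q ^ 2) ^ 2 * (4 + q))
          (by positivity) (by ring1)

theorem im_mul_midValue_mul_conj_endValue (hq : 0 < q) (hz : 0 < z.im) (j : Fin 5) :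
    0 ≤ (z * midValue q z j * (starRingEnd ℂ) (endValue q z)).im := by
  have h := (im_cubic_mul_conj_cubic (f₀ := 0) (f₁ := midCoeff q j 0)
    (f₂ := midCoeff q j 1) (f₃ := midCoeff q j 2) (g₀ := 1) (g₁ := 4 + 6 * q + q ^ 2)
    (g₂ := 1 + 6 * q + 4 * q ^ 2) (g₃ := q ^ 2) rfl rfl rfl rfl rfl rfl ?_ ?_ ?_ hz).1
  · convert h using 3
    · simp [midValue]; ring
    · simp [endValue]
  · fin_cases j <;> simp [midCoeff, -sub_pos, -sub_nonneg] <;> ring_nf <;> positivity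
  · fin_cases j <;> simp [midCoeff, -sub_pos, -sub_nonneg] <;> ring_nf <;> positivity
  · fin_cases j <;> simp [midCoeff, -sub_pos, -sub_nonneg] <;> first
      | (ring_nf; positivity)
      | exact le_of_le_of_eq (b := 12 * q * (1 - q ^ 2) ^ 2 * (4 + q)) (by positivity) (by ring1)
      | exact le_of_le_of_eq (b := 12 * q ^ 2 * (1 - q ^ 2) ^ 2) (by positivity) (by ring1)

variable (q z) in
/-- Up to positive factors, the values of the distinct `T_{4,i}`, in order. -/
noncomputable def baseValue (k : ℕ) : ℂ :=
  if k = 0 then endValue q z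
  else if h : k - 1 < 5 then z * midValue q z ⟨k - 1, h⟩ else z * endValue q z

theorem sectorOrdered_baseValue (hq : 0 < q) (hz : 0 < z.im) :
    SectorOrdered z 7 (baseValue q z) := by
  have hz0 : z ≠ 0 := fun h => hz.ne' (by simp [h])
  have h0 : baseValue q z 0 = endValue q z := rfl
  have h6 : baseValue q z 6 = z * endValue q z := rfl
  have hmid : ∀ k, 0 < k → k < 6 → ∃ j : Fin 5, j.val + 1 = k ∧
      baseValue q z k = z * midValue q z j := by
    intro k h1 h2
    refine ⟨⟨k - 1, by omega⟩, Nat.sub_add_cancel h1, ?_⟩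
    rw [baseValue, if_neg h1.ne', dif_pos (by omega)]
  -- A common factor z only contributes |z|², so every pair reduces to one of the four preceding
  -- comparisons or to a value paired with itself.
  have hmul : ∀ a b : ℂ, (z * a * (starRingEnd ℂ) (z * b)).im =
      Complex.normSq z * (a * (starRingEnd ℂ) b).im := by
    intro a b
    simp [Complex.normSq_apply]
    ring
  have hmul' : ∀ a b : ℂ, (z * (z * a) * (starRingEnd ℂ) (z * b)).im =
      Complex.normSq z * (z * a * (starRingEnd ℂ) b).im := fun a b => by
    rw [hmul]
  have hn := Complex.normSq_nonneg z
  refine ⟨fun k hk => ?_, fun k l hkl hl => ?_, fun k l hkl hl => ?_⟩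
  · rcases Nat.eq_zero_or_pos k with rfl | hk0
    · exact endValue_ne_zero hq hz
    · rcases (Nat.lt_succ_iff.1 hk).eq_or_lt with rfl | hk6
      · exact mul_ne_zero hz0 (endValue_ne_zero hq hz)
      · obtain ⟨j, -, h⟩ := hmid k hk0 hk6
        rw [h]
        exact mul_ne_zero hz0 (midValue_ne_zero hq hz j)
  · rcases Nat.eq_zero_or_pos k with rfl | hk0 <;>
      rcases (Nat.lt_succ_iff.1 hl).eq_or_lt with rfl | hl6
    · rw [h0, h6, im_mul_mul_conj_self]
      exact mul_nonneg hz.le (Complex.normSq_nonneg _)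
    · obtain ⟨j, -, h⟩ := hmid l hkl hl6
      rw [h0, h]
      exact im_mul_midValue_mul_conj_endValue hq hz j
    · obtain ⟨j, -, h⟩ := hmid k hk0 hkl
      rw [h6, h, hmul]
      exact mul_nonneg hn (im_endValue_mul_conj_midValue hq hz j)
    · obtain ⟨i, hi, h⟩ := hmid k hk0 (hkl.trans hl6)
      obtain ⟨j, hj, h'⟩ := hmid l (hk0.trans hkl) hl6
      rw [h, h', hmul]
      exact mul_nonneg hn (im_midValue_mul_conj_midValue hq hz (Fin.lt_def.2 (by omega)))
  · rcases Nat.eq_zero_or_pos k with rfl | hk0 <;>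
      rcases (Nat.lt_succ_iff.1 hl).eq_or_lt with rfl | hl6
    · rw [h0, h6, Complex.im_mul_conj_self_eq_zero]
    · obtain ⟨j, -, h⟩ := hmid l hkl hl6
      rw [h0, h, hmul]
      exact mul_nonneg hn (im_endValue_mul_conj_midValue hq hz j)
    · obtain ⟨j, -, h⟩ := hmid k hk0 hkl
      rw [h6, h, hmul']
      exact mul_nonneg hn (im_mul_midValue_mul_conj_endValue hq hz j)
    · obtain ⟨i, hi, h⟩ := hmid k hk0 (hkl.trans hl6)
      obtain ⟨j, hj, h'⟩ := hmid l (hk0.trans hkl) hl6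
      rw [h, h', hmul']
      exact mul_nonneg hn (im_mul_midValue_mul_conj_midValue hq hz (Fin.lt_def.2 (by omega)))

end

/-! ### The induction on the length -/

theorem aeval_refinedEulerianD_succ {n i : ℕ} (hn : 2 ≤ n) (hi : i < 2 * (n + 1)) (q : ℝ)
    (z : ℂ) :
    aeval z (refinedEulerianD (n + 1) i q) = ((if n + 1 ≤ i then q else 1 : ℝ) : ℂ) *
      ∑ l ∈ Finset.range (2 * n), (if (l : ℚ) / n < (i : ℚ) / ((n : ℚ) + 1) then z else 1) *
        aeval z (refinedEulerianD n l q) := by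
  rw [refinedEulerianD_succ hn hi, map_mul, aeval_C, map_sum]
  congr 1
  refine Finset.sum_congr rfl fun l _ => ?_
  rw [map_mul]
  congr 1
  split_ifs <;> simp

theorem aeval_refinedEulerianD_three (q : ℝ) (z : ℂ) :
    aeval z (refinedEulerianD 3 0 q) = (1 + q) * ((1 + z) * (1 + q * z)) ∧
    aeval z (refinedEulerianD 3 1 q) = (1 + q) * (z * (2 + q + q * z)) ∧
    aeval z (refinedEulerianD 3 2 q) = (1 + q) * ((1 + q) * z * (1 + z)) ∧
    aeval z (refinedEulerianD 3 3 q) = (1 + q) * (q * (1 + q) * z * (1 + z)) ∧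
    aeval z (refinedEulerianD 3 4 q) = (1 + q) * (q * z * (1 + (1 + 2 * q) * z)) ∧
    aeval z (refinedEulerianD 3 5 q) = (1 + q) * (q * z * (1 + z) * (1 + q * z)) := by
  obtain ⟨h0, h1, h2, h3⟩ := refinedEulerianD_two q
  have h := fun i hi => aeval_refinedEulerianD_succ (n := 2) (i := i) le_rfl hi q z
  simp only [Nat.reduceMul, Finset.sum_range_succ, Finset.sum_range_zero, h0, h1, h2, h3] at h
  refine ⟨?_, ?_, ?_, ?_, ?_, ?_⟩ <;> rw [h _ (by norm_num)] <;> norm_num <;> ring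

theorem aeval_refinedEulerianD_four (q : ℝ) (z : ℂ) {i : ℕ} (hi : i < 8) :
    aeval z (refinedEulerianD 4 i q) =
      (((if 4 ≤ i then q else 1) * if i = 1 ∨ i = 6 then (1 + q) ^ 2 else 1 + q : ℝ) : ℂ) *
        baseValue q z (if 4 ≤ i then i - 1 else i) := by
  obtain ⟨h0, h1, h2, h3, h4, h5⟩ := aeval_refinedEulerianD_three q z
  have h := aeval_refinedEulerianD_succ (n := 3) (i := i) (by norm_num) hi q z
  simp only [Nat.reduceMul, Finset.sum_range_succ, Finset.sum_range_zero, h0, h1, h2, h3, h4,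
    h5] at h
  rw [h]
  interval_cases i <;> norm_num [baseValue] <;>
    simp [midValue, endValue, midCoeff] <;> ring

theorem sectorOrdered_refinedEulerianD {n : ℕ} (hn : 4 ≤ n) {q : ℝ} (hq : 0 < q) {z : ℂ}
    (hz : 0 < z.im) :
    SectorOrdered z (2 * n) fun i => aeval z (refinedEulerianD n i q) := by
  induction n, hn using Nat.le_induction with
  | base =>
    refine (sectorOrdered_baseValue hq hz).smul_comp hz
      -- The entries i = 3 and i = 4 are proportional, so eight polynomials come from seven base
      -- values.
      (τ := fun i => if 4 ≤ i then i - 1 else i)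
      (c := fun i => (if 4 ≤ i then q else 1) * if i = 1 ∨ i = 6 then (1 + q) ^ 2 else 1 + q)
      ?_ ?_ ?_ fun i hi => aeval_refinedEulerianD_four q z hi
    · intro i j hij
      dsimp only
      split_ifs <;> omega
    · intro i hi
      split_ifs <;> omega
    · intro i _
      split_ifs <;> positivity
  | succ n hn ih =>
    have hn0 : (0 : ℚ) < n := by exact_mod_cast (by omega : 0 < n)
    -- This treats the sums without the factor q, which enters afterwards as a positive scaling.
    have step := ih.transform hz (m' := 2 * (n + 1)) (by omega)
      (p := fun i l => (l : ℚ) / n < (i : ℚ) / ((n : ℚ) + 1))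
      (fun i l l' hl h => lt_of_le_of_lt (by gcongr) h)
      (fun i i' l hi h => lt_of_lt_of_le h (by gcongr))
      (fun i _ => rfl)
    exact step.smul_comp hz (τ := id) (c := fun i => if n + 1 ≤ i then q else 1) monotone_id
      (fun i hi => hi) (fun i _ => by split_ifs <;> positivity)
      fun i hi => aeval_refinedEulerianD_succ (by omega) hi q z

theorem refinedEulerianD_coeff_nonneg (n i : ℕ) {q : ℝ} (hq : 0 < q) (k : ℕ) :
    0 ≤ (refinedEulerianD n i q).coeff k := by
  unfold refinedEulerianD
  rw [finsetSum_coeff]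
  refine Finset.sum_nonneg fun e _ => ?_
  split_ifs
  · rw [coeff_C_mul_X_pow]
    split_ifs <;> positivity
  · simp

theorem proposition3p2 (n : ℕ) (hn : 4 ≤ n) (q : ℝ) (hq : 0 < q) :
    MutuallyInterlacing (fun i : Fin (2 * n) => refinedEulerianD n i.val q) := by
  have hne : ∀ i : Fin (2 * n), ∀ z : ℂ, 0 < z.im →
      aeval z (refinedEulerianD n i.val q) ≠ 0 := fun i z hz =>
    (sectorOrdered_refinedEulerianD hn hq hz).ne_zero i i.is_lt
  have hlc : ∀ i : Fin (2 * n), 0 < (refinedEulerianD n i.val q).leadingCoeff := by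
    intro i
    -- All coefficients are nonnegative, and the polynomial is nonzero because its value at the
    -- imaginary unit is.
    refine lt_of_le_of_ne (refinedEulerianD_coeff_nonneg n i hq _) (Ne.symm ?_)
    rw [leadingCoeff_ne_zero]
    intro h
    exact hne i Complex.I (by simp) (by rw [h, map_zero])
  refine ⟨hlc, fun i j hij => ?_⟩
  exact HalfPlaneLE.interlaces
    (fun z hz => (sectorOrdered_refinedEulerianD hn hq hz).im_nonneg i j hij j.is_lt)
    (splits_of_aeval_ne_zero (hne i)) (hlc i) (splits_of_aeval_ne_zero (hne j)) (hlc j)
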